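/- Let $n\ge 0$ and let $\mathrm{Cvx}_0(\mathbb R^n)$ be the class of geometric convex functions, i.e. of convex functions $\phi:\mathbb R^n\to[0,+\infty]$ with $\phi(0)=0$ whose epigraph $\mathrm{epi}(\phi)=\{(x,t)\in\mathbb R^n\times\mathbb R:\phi(x)\le t\}$ is closed. For functions $\psi_m,\psi:\mathbb R^n\to[-\infty,+\infty]$, write $\psi_m\xrightarrow{\tau}\psi$ (epi-convergence) if $\limsup_m \mathrm{epi}(\psi_m)\subseteq \mathrm{epi}(\psi)\subseteq\liminf_m \mathrm{epi}(\psi_m)$. Here, for a sequence of sets $K_m$, $\limsup_m K_m$ is the set of all limits of convergent sequences $(x_j)$ with $x_j\in K_{m_j}$ for some $m_1<m_2<\cdots$, and $\liminf_m K_m$ is the set of all limits of convergent sequences $(x_m)$ with $x_m\in K_m$ for all but finitely many $m$. For $\phi\in\mathrm{Cvx}_0(\mathbb R^n)$ define the polarity transform $$\mathcal A\phi(y)=\begin{cases}0, & y=0,\\ \displaystyle\sup_{\{x:\,\phi(x)>0\}}\frac{\langle x,y\rangle-1}{\phi(x)}, & 0\ne y\in\{\phi=0\}^\circ,\\ +\infty,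 & y\notin\{\phi=0\}^\circ,\end{cases}$$ where $S^\circ=\{y:\langle x,y\rangle\le 1\ \text{for all } x\in S\}$ and $\frac{c}{+\infty}=0$ for $c\in\mathbb R$, and the gauge transform $$\mathcal J\phi(x)=\inf\left\{r>0:\ \phi\!\left(\tfrac{x}{r}\right)\le\tfrac1r\right\},\qquad \inf\emptyset=+\infty .$$ Let $(\phi_m)_{m}$ be a sequence in $\mathrm{Cvx}_0(\mathbb R^n)$ and let $\phi\in\mathrm{Cvx}_0(\mathbb R^n)$. Then $$\phi_m\xrightarrow{\tau}\phi\iff\mathcal A\phi_m\xrightarrow{\tau}\mathcal A\phi,\qquad\text{and}\qquad \phi_m\xrightarrow{\tau}\phi\iff\mathcal J\phi_m\xrightarrow{\tau}\mathcal J\phi .$$ -/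

import Mathlib

open Filter Topology

namespace GeomConvex

/-- The (outer) upper limit of a sequence of sets: all limits of points `x j ∈ K (m j)` taken along
some subsequence of indices. -/
def limsupSet {X : Type*} [TopologicalSpace X] (K : ℕ → Set X) : Set X :=
  {p | ∃ m : ℕ → ℕ, StrictMono m ∧ ∃ x : ℕ → X, (∀ j, x j ∈ K (m j)) ∧ Tendsto x atTop (𝓝 p)}

/-- The (inner) lower limit of a sequence of sets: all limits of points `x m ∈ K m` taken for all
but finitely many indices. -/
def liminfSet {X : Type*} [TopologicalSpace X] (K : ℕ → Set X) : Set X :=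
  {p | ∃ x : ℕ → X, (∀ᶠ m in atTop, x m ∈ K m) ∧ Tendsto x atTop (𝓝 p)}

/-- Convergence of a sequence of sets in the `τ`-topology (Painlevé–Kuratowski convergence). -/
def SetTauTendsto {X : Type*} [TopologicalSpace X] (K : ℕ → Set X) (L : Set X) : Prop :=
  limsupSet K ⊆ L ∧ L ⊆ liminfSet K

/-- The epigraph of an extended-real-valued function, a subset of `X × ℝ`. -/
def epi {X : Type*} (φ : X → EReal) : Set (X × ℝ) :=
  {p | φ p.1 ≤ (p.2 : EReal)}

/-- Convergence of functions in the `τ`-topology (epi-convergence). -/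
def TauTendsto {X : Type*} [TopologicalSpace X] (φs : ℕ → X → EReal) (φ : X → EReal) : Prop :=
  SetTauTendsto (fun m => epi (φs m)) (epi φ)

/-- Geometric convex functions on `ℝⁿ`: non-negative closed convex functions, possibly with the
value `+∞`, vanishing at the origin. Convexity and closedness are those of the epigraph. -/
structure IsGeometricConvex {n : ℕ} (φ : EuclideanSpace ℝ (Fin n) → EReal) : Prop where
  nonneg : ∀ x, 0 ≤ φ x
  map_zero : φ 0 = 0
  convex_epi : Convex ℝ (epi φ)
  isClosed_epi : IsClosed (epi φ)

/-- The (one-sided) polar set `S° = {y | ⟨x, y⟩ ≤ 1 for all x ∈ S}`. -/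
def polarSet {n : ℕ} (S : Set (EuclideanSpace ℝ (Fin n))) : Set (EuclideanSpace ℝ (Fin n)) :=
  {y | ∀ x ∈ S, inner ℝ x y ≤ 1}

open Classical in
/-- The polarity transform `𝒜 φ`. In the supremum, a point `x` with `φ x = +∞` contributes
the value `0`. -/
noncomputable def polarTransform {n : ℕ} (φ : EuclideanSpace ℝ (Fin n) → EReal)
    (y : EuclideanSpace ℝ (Fin n)) : EReal :=
  if y = 0 then 0
  else if y ∈ polarSet {x | φ x = 0} then
    ⨆ x ∈ {x | 0 < φ x}, ((inner ℝ x y - 1 : ℝ) : EReal) / φ x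
  else ⊤

/-- The gauge transform `(𝒥 φ)(x) = inf {r > 0 | φ (x / r) ≤ 1 / r}`, with `inf ∅ = +∞`. -/
noncomputable def gaugeTransform {n : ℕ} (φ : EuclideanSpace ℝ (Fin n) → EReal)
    (x : EuclideanSpace ℝ (Fin n)) : EReal :=
  sInf (Real.toEReal '' {r : ℝ | 0 < r ∧ φ (r⁻¹ • x) ≤ ((r⁻¹ : ℝ) : EReal)})

end GeomConvex

/-!
Both transforms act geometrically on epigraphs. Up to the reflection `t ↦ -t`, the epigraph of
`𝒜 φ` is the polar of the epigraph of `φ` in `ℝⁿ × ℝ`; over positive heights, the epigraph of `𝒥 φ`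
is the image of the epigraph of `φ` under the involution `(x, t) ↦ (x / t, 1 / t)`.

Polarity is continuous on closed convex sets `K m` containing the origin. If a point `y` of the
polar of the upper limit stayed at distance `ε` from the polars of infinitely many `K m`, then
projecting `y` on those polars and using the bipolar theorem would give `w ∈ K m` with
`‖w‖ ≤ 2 / ε` and `1 + ε / 2 * ‖w‖ ≤ ⟪w, y⟫`. A cluster point of these `w` belongs to the upper
limit, so it satisfies `⟪w, y⟫ ≤ 1`; this forces `w = 0`, which is absurd. By the bipolar theorem,
convergence of the polars implies convergence of the sets themselves.

For the gauge transform, convergence over positive heights is transported by the involution, and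
it determines convergence up to height `0` because vertical sections of epigraphs are closed
half-lines.
-/

open Metric Set

namespace GeomConvex

section SetLimits

variable {X Y : Type*} [TopologicalSpace X] [TopologicalSpace Y]

theorem mem_liminfSet_iff [FirstCountableTopology X] {K : ℕ → Set X} {p : X} :
    p ∈ liminfSet K ↔ ∀ U ∈ 𝓝 p, ∀ᶠ m in atTop, (K m ∩ U).Nonempty := by
  classical
  constructor
  · rintro ⟨x, hxK, hxp⟩ U hU
    filter_upwards [hxK, hxp hU] with m hmK hmU using ⟨x m, hmK, hmU⟩
  · intro h
    obtain ⟨V, hV⟩ := (𝓝 p).exists_antitone_basis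
    -- `k m` is the index of the smallest of `V 0, …, V m` that meets `K m`.
    let k (m : ℕ) : ℕ := Nat.findGreatest (fun i => (K m ∩ V i).Nonempty) m
    have hk : ∀ i, ∀ᶠ m in atTop, i ≤ k m ∧ (K m ∩ V (k m)).Nonempty := fun i => by
      filter_upwards [h (V i) (hV.mem i), eventually_ge_atTop i] with m hm him
      exact ⟨Nat.le_findGreatest him hm, Nat.findGreatest_spec (P := fun i => (K m ∩ V i).Nonempty)
        him hm⟩
    have : Nonempty X := ⟨p⟩
    obtain ⟨x, hx⟩ : ∃ x : ℕ → X, ∀ᶠ m in atTop, x m ∈ K m ∩ V (k m) :=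
      ((hk 0).mono fun m hm => hm.2).choice
    refine ⟨x, hx.mono fun m hm => hm.1, hV.tendsto_right_iff.2 fun i _ => ?_⟩
    filter_upwards [hx, hk i] with m hmx hmk using hV.antitone hmk.1 hmx.2

theorem isClosed_liminfSet [FirstCountableTopology X] (K : ℕ → Set X) :
    IsClosed (liminfSet K) := by
  refine isClosed_of_closure_subset fun p hp => mem_liminfSet_iff.2 fun U hU => ?_
  obtain ⟨q, hqU, hq⟩ := mem_closure_iff_nhds.1 hp _ (interior_mem_nhds.2 hU)
  exact mem_liminfSet_iff.1 hq U (mem_interior_iff_mem_nhds.1 hqU)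

theorem limsupSet_subset_of_isClosed {K : ℕ → Set X} {C : Set X} (hC : IsClosed C)
    (hK : ∀ m, K m ⊆ C) : limsupSet K ⊆ C := by
  rintro p ⟨m, -, x, hx, hxp⟩
  exact hC.mem_of_tendsto hxp (.of_forall fun j => hK _ (hx j))

theorem map_mem_limsupSet {f : X → Y} {K : ℕ → Set X} {K' : ℕ → Set Y} {U : Set X} {p : X}
    (hf : ContinuousAt f p) (hU : U ∈ 𝓝 p) (hK : ∀ m, MapsTo f (K m ∩ U) (K' m))
    (hp : p ∈ limsupSet K) : f p ∈ limsupSet K' := by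
  obtain ⟨m, hm, x, hxK, hxp⟩ := hp
  obtain ⟨N, hN⟩ := eventually_atTop.1 (hxp hU)
  exact ⟨fun j => m (j + N), fun i j hij => hm (by lia), fun j => f (x (j + N)),
    fun j => hK _ ⟨hxK _, hN _ (by lia)⟩,
    (tendsto_add_atTop_iff_nat N).2 (hf.tendsto.comp hxp)⟩

theorem map_mem_liminfSet {f : X → Y} {K : ℕ → Set X} {K' : ℕ → Set Y} {U : Set X} {p : X}
    (hf : ContinuousAt f p) (hU : U ∈ 𝓝 p) (hK : ∀ m, MapsTo f (K m ∩ U) (K' m))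
    (hp : p ∈ liminfSet K) : f p ∈ liminfSet K' := by
  obtain ⟨x, hxK, hxp⟩ := hp
  refine ⟨fun m => f (x m), ?_, hf.tendsto.comp hxp⟩
  filter_upwards [hxK, hxp hU] with m hmK hmU using hK m ⟨hmK, hmU⟩

/-- Painlevé–Kuratowski convergence inside `U`: the two inclusions defining `SetTauTendsto` are only
required at the points of `U`. It allows convergence to be transported along maps that are defined
only on an open set. -/
def SetTauTendstoOn (U : Set X) (K : ℕ → Set X) (L : Set X) : Prop :=
  limsupSet K ∩ U ⊆ L ∧ L ∩ U ⊆ liminfSet K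

theorem setTauTendstoOn_univ {K : ℕ → Set X} {L : Set X} :
    SetTauTendstoOn univ K L ↔ SetTauTendsto K L := by
  simp only [SetTauTendstoOn, SetTauTendsto, inter_univ]

theorem SetTauTendstoOn.of_isImage {e : OpenPartialHomeomorph X Y} {K : ℕ → Set X} {L : Set X}
    {K' : ℕ → Set Y} {L' : Set Y} (hK : ∀ m, e.IsImage (K m) (K' m)) (hL : e.IsImage L L')
    (h : SetTauTendstoOn e.source K L) : SetTauTendstoOn e.target K' L' := by
  constructor
  · rintro y ⟨hy, hyt⟩
    have hy' : e.symm y ∈ limsupSet K :=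
      map_mem_limsupSet (e.symm.continuousAt hyt) (e.open_target.mem_nhds hyt)
        (fun m _ hz => ((hK m).symm_apply_mem_iff hz.2).2 hz.1) hy
    exact (hL.symm_apply_mem_iff hyt).1 (h.1 ⟨hy', e.map_target hyt⟩)
  · rintro y ⟨hy, hyt⟩
    have hy' : e.symm y ∈ liminfSet K :=
      h.2 ⟨(hL.symm_apply_mem_iff hyt).2 hy, e.map_target hyt⟩
    rw [← e.right_inv hyt]
    exact map_mem_liminfSet (e.continuousAt (e.map_target hyt))
      (e.open_source.mem_nhds (e.map_target hyt))
      (fun m _ hz => ((hK m).apply_mem_iff hz.2).2 hz.1) hy'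

theorem setTauTendstoOn_iff_of_isImage {e : OpenPartialHomeomorph X Y} {K : ℕ → Set X} {L : Set X}
    {K' : ℕ → Set Y} {L' : Set Y} (hK : ∀ m, e.IsImage (K m) (K' m)) (hL : e.IsImage L L') :
    SetTauTendstoOn e.source K L ↔ SetTauTendstoOn e.target K' L' :=
  ⟨.of_isImage hK hL, .of_isImage (e := e.symm) (fun m => (hK m).symm) hL.symm⟩

theorem setTauTendsto_preimage_iff (e : X ≃ₜ Y) {K : ℕ → Set Y} {L : Set Y} :
    SetTauTendsto (fun m => e ⁻¹' K m) (e ⁻¹' L) ↔ SetTauTendsto K L := by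
  rw [← setTauTendstoOn_univ, ← setTauTendstoOn_univ]
  exact setTauTendstoOn_iff_of_isImage (e := e.toOpenPartialHomeomorph) (fun _ _ _ => Iff.rfl)
    fun _ _ => Iff.rfl

end SetLimits

section Polar

variable {F : Type*} [NormedAddCommGroup F] [InnerProductSpace ℝ F]

/-- The one-sided polar of a subset of a real inner product space. It is `polarSet`, with
`EuclideanSpace ℝ (Fin n)` replaced by a space that may be the `ℓ²`-product containing the
epigraphs. -/
def innerPolar (S : Set F) : Set F :=
  {y | ∀ x ∈ S, inner ℝ x y ≤ 1}

theorem innerPolar_anti {S T : Set F} (h : S ⊆ T) : innerPolar T ⊆ innerPolar S :=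
  fun _ hy x hx => hy x (h hx)

theorem zero_mem_innerPolar (S : Set F) : (0 : F) ∈ innerPolar S := fun x _ => by
  rw [inner_zero_right]
  exact zero_le_one

theorem innerPolar_eq_biInter (S : Set F) :
    innerPolar S = ⋂ x ∈ S, {y | innerSL ℝ x y ≤ 1} := by
  ext y
  simp only [innerPolar, mem_ofPred_eq, mem_iInter, innerSL_apply_apply]

theorem convex_innerPolar (S : Set F) : Convex ℝ (innerPolar S) := by
  rw [innerPolar_eq_biInter]
  exact convex_iInter₂ fun x _ => convex_halfSpace_le (innerSL ℝ x).isLinear 1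

theorem isClosed_innerPolar (S : Set F) : IsClosed (innerPolar S) := by
  rw [innerPolar_eq_biInter]
  exact isClosed_biInter fun x _ => isClosed_le (innerSL ℝ x).continuous continuous_const

theorem exists_mem_innerPolar_of_disjoint_ball [CompleteSpace F] {K : Set F} (hc : Convex ℝ K)
    (hcl : IsClosed K) (h0 : (0 : F) ∈ K) {z : F} {ε : ℝ} (hε : 0 < ε)
    (hz : Disjoint K (ball z ε)) :
    ∃ w ∈ innerPolar K, ‖w‖ ≤ 2 / ε ∧ 1 + ε / 2 * ‖w‖ ≤ inner ℝ w z := by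
  obtain ⟨p, hp, hpmin⟩ := exists_norm_eq_iInf_of_complete_convex ⟨0, h0⟩ hcl.isComplete hc z
  have hproj := (norm_eq_iInf_iff_real_inner_le_zero hc hp).1 hpmin
  set u := z - p
  have hεu : ε ≤ ‖u‖ := by
    rw [← dist_eq_norm, dist_comm]
    exact not_lt.1 (disjoint_left.1 hz hp)
  have hup : 0 ≤ inner ℝ u p := by simpa using hproj 0 h0
  have huz : inner ℝ u z = inner ℝ u p + ‖u‖ ^ 2 := by
    rw [← real_inner_self_eq_norm_sq, ← inner_add_right, add_sub_cancel]
  -- The hyperplane `⟪u, ·⟫ = c` is orthogonal to `z - p` and halfway between `z` and `p`.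
  set c := inner ℝ u p + ‖u‖ ^ 2 / 2 with hc_def
  have hu : 0 < ‖u‖ := hε.trans_le hεu
  have hc0 : 0 < c := by positivity
  have hnorm : ‖c⁻¹ • u‖ = ‖u‖ / c := by
    rw [norm_smul, norm_inv, Real.norm_of_nonneg hc0.le, inv_mul_eq_div]
  refine ⟨c⁻¹ • u, fun k hk => ?_, ?_, ?_⟩
  · have hk' := hproj k hk
    rw [inner_sub_right] at hk'
    rw [real_inner_smul_right, real_inner_comm, inv_mul_le_iff₀ hc0]
    linarith [sq_nonneg ‖u‖]
  · rw [hnorm, div_le_div_iff₀ hc0 hε]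
    nlinarith
  · rw [hnorm, real_inner_smul_left, huz, inv_mul_eq_div, mul_div_assoc', le_div_iff₀ hc0, add_mul,
      div_mul_cancel₀ _ hc0.ne']
    nlinarith

theorem one_lt_of_one_add_mul_norm_le_inner {w z : F} {δ : ℝ} (hδ : 0 < δ)
    (h : 1 + δ * ‖w‖ ≤ inner ℝ w z) : 1 < inner ℝ w z := by
  have hw : 0 < ‖w‖ := norm_pos_iff.2 fun hw => by
    rw [hw, inner_zero_left, norm_zero] at h
    linarith
  linarith [mul_pos hδ hw]

theorem innerPolar_innerPolar [CompleteSpace F] {K : Set F} (hc : Convex ℝ K)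
    (hcl : IsClosed K) (h0 : (0 : F) ∈ K) : innerPolar (innerPolar K) = K := by
  refine Subset.antisymm (fun z hz => ?_) fun x hx y hy => real_inner_comm x y ▸ hy x hx
  by_contra hzK
  obtain ⟨ε, hε, hball⟩ := Metric.isOpen_iff.1 hcl.isOpen_compl z hzK
  obtain ⟨w, hw, -, hwz⟩ := exists_mem_innerPolar_of_disjoint_ball hc hcl h0 hε
    (disjoint_left.2 fun _ hk hkz => hball hkz hk)
  exact (one_lt_of_one_add_mul_norm_le_inner (half_pos hε) hwz).not_ge (hz w hw)

theorem limsupSet_innerPolar_subset (K : ℕ → Set F) :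
    limsupSet (fun m => innerPolar (K m)) ⊆ innerPolar (liminfSet K) := by
  rintro y ⟨m, hm, ys, hys, hy⟩ x ⟨xs, hxs, hx⟩
  refine le_of_tendsto ((hx.comp hm.tendsto_atTop).inner hy) ?_
  filter_upwards [hm.tendsto_atTop.eventually hxs] with j hj using hys j _ hj

theorem innerPolar_limsupSet_subset [FiniteDimensional ℝ F] {K : ℕ → Set F}
    (hc : ∀ m, Convex ℝ (K m)) (hcl : ∀ m, IsClosed (K m)) (h0 : ∀ m, (0 : F) ∈ K m) :
    innerPolar (limsupSet K) ⊆ liminfSet fun m => innerPolar (K m) := by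
  have : CompleteSpace F := FiniteDimensional.complete ℝ F
  intro y hy
  by_contra hnot
  obtain ⟨ε, hε, hfreq⟩ : ∃ ε > 0, ∃ᶠ m in atTop, Disjoint (innerPolar (K m)) (ball y ε) := by
    simp only [mem_liminfSet_iff, not_forall, not_eventually, not_nonempty_iff_eq_empty,
      ← disjoint_iff_inter_eq_empty] at hnot
    obtain ⟨U, hU, hfreq⟩ := hnot
    obtain ⟨ε, hε, hball⟩ := Metric.mem_nhds_iff.1 hU
    exact ⟨ε, hε, hfreq.mono fun m hm => hm.mono_right hball⟩
  obtain ⟨m, hm, hdisj⟩ := extraction_of_frequently_atTop hfreq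
  have hsep : ∀ j, ∃ w ∈ K (m j), ‖w‖ ≤ 2 / ε ∧ 1 + ε / 2 * ‖w‖ ≤ inner ℝ w y := fun j => by
    have := exists_mem_innerPolar_of_disjoint_ball (convex_innerPolar _) (isClosed_innerPolar _)
      (zero_mem_innerPolar _) hε (hdisj j)
    rwa [innerPolar_innerPolar (hc _) (hcl _) (h0 _)] at this
  choose w hwK hwε hwy using hsep
  obtain ⟨w₀, -, σ, hσ, hlim⟩ := (isCompact_closedBall (0 : F) (2 / ε)).tendsto_subseq
    fun j => mem_closedBall_zero_iff.2 (hwε j)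
  have hw₀ : w₀ ∈ limsupSet K := ⟨m ∘ σ, hm.comp hσ, w ∘ σ, fun j => hwK _, hlim⟩
  have hw₀y : 1 + ε / 2 * ‖w₀‖ ≤ inner ℝ w₀ y :=
    le_of_tendsto_of_tendsto' ((hlim.norm.const_mul _).const_add _)
      (hlim.inner tendsto_const_nhds) fun j => hwy (σ j)
  exact (one_lt_of_one_add_mul_norm_le_inner (half_pos hε) hw₀y).not_ge (hy w₀ hw₀)

theorem SetTauTendsto.innerPolar [FiniteDimensional ℝ F] {K : ℕ → Set F} {L : Set F}
    (hc : ∀ m, Convex ℝ (K m)) (hcl : ∀ m, IsClosed (K m)) (h0 : ∀ m, (0 : F) ∈ K m)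
    (h : SetTauTendsto K L) :
    SetTauTendsto (fun m => GeomConvex.innerPolar (K m)) (GeomConvex.innerPolar L) :=
  ⟨(limsupSet_innerPolar_subset K).trans (innerPolar_anti h.2),
    (innerPolar_anti h.1).trans (innerPolar_limsupSet_subset hc hcl h0)⟩

theorem setTauTendsto_innerPolar_iff [FiniteDimensional ℝ F] {K : ℕ → Set F} {L : Set F}
    (hc : ∀ m, Convex ℝ (K m)) (hcl : ∀ m, IsClosed (K m)) (h0 : ∀ m, (0 : F) ∈ K m)
    (hcL : Convex ℝ L) (hclL : IsClosed L) (h0L : (0 : F) ∈ L) :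
    SetTauTendsto (fun m => innerPolar (K m)) (innerPolar L) ↔ SetTauTendsto K L := by
  have : CompleteSpace F := FiniteDimensional.complete ℝ F
  refine ⟨fun h => ?_, .innerPolar hc hcl h0⟩
  have hbipolar := h.innerPolar (fun m => convex_innerPolar _) (fun m => isClosed_innerPolar _)
    fun m => zero_mem_innerPolar _
  simpa only [innerPolar_innerPolar (hc _) (hcl _) (h0 _), innerPolar_innerPolar hcL hclL h0L]
    using hbipolar

end Polar

section Epigraph

variable {X : Type*} {φ : X → EReal}

theorem mem_epi {x : X} {t : ℝ} : (x, t) ∈ epi φ ↔ φ x ≤ t := Iff.rfl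

theorem epi_subset_nonneg_snd (hφ : ∀ x, 0 ≤ φ x) : epi φ ⊆ {p | 0 ≤ p.2} :=
  fun p hp => EReal.coe_nonneg.1 ((hφ p.1).trans hp)

theorem mem_epi_of_forall_gt {x : X} {r : ℝ} (h : ∀ s > r, (x, s) ∈ epi φ) : (x, r) ∈ epi φ :=
  EReal.le_of_forall_lt_iff_le.1 fun s hs => h s (EReal.coe_lt_coe_iff.1 hs)

theorem mapsTo_add_snd_epi (φ : X → EReal) {δ : ℝ} (hδ : 0 ≤ δ) :
    MapsTo (fun p : X × ℝ => (p.1, p.2 + δ)) (epi φ) (epi φ) :=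
  fun _ hp => le_trans hp (EReal.coe_le_coe_iff.2 (le_add_of_nonneg_right hδ))

variable [TopologicalSpace X]

theorem mem_limsupSet_epi_of_le {φs : ℕ → X → EReal} {x : X} {r s : ℝ} (hrs : r ≤ s)
    (h : (x, r) ∈ limsupSet fun m => epi (φs m)) : (x, s) ∈ limsupSet fun m => epi (φs m) := by
  have := map_mem_limsupSet (f := fun p : X × ℝ => (p.1, p.2 + (s - r))) (by fun_prop) univ_mem
    (fun m => (mapsTo_add_snd_epi (φs m) (sub_nonneg.2 hrs)).mono_left inter_subset_left) h
  rwa [add_sub_cancel] at this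

theorem tauTendsto_iff_setTauTendstoOn_pos [FirstCountableTopology X] {φs : ℕ → X → EReal}
    (hφs : ∀ m x, 0 ≤ φs m x) (hφ : ∀ x, 0 ≤ φ x) :
    TauTendsto φs φ ↔ SetTauTendstoOn {p | 0 < p.2} (fun m => epi (φs m)) (epi φ) := by
  refine ⟨fun h => ⟨inter_subset_left.trans h.1, inter_subset_left.trans h.2⟩, fun h => ⟨?_, ?_⟩⟩
  · rintro ⟨x, r⟩ hx
    have hr : 0 ≤ r := limsupSet_subset_of_isClosed (isClosed_le continuous_const continuous_snd)
      (fun m => epi_subset_nonneg_snd (hφs m)) hx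
    exact mem_epi_of_forall_gt fun s hs =>
      h.1 ⟨mem_limsupSet_epi_of_le (le_of_lt hs) hx, hr.trans_lt hs⟩
  · rintro ⟨x, r⟩ hx
    have hr : 0 ≤ r := epi_subset_nonneg_snd hφ hx
    have htendsto : Tendsto (fun s : ℝ => (x, s)) (𝓝[>] r) (𝓝 (x, r)) :=
      (Continuous.prodMk_right x).continuousWithinAt
    refine (isClosed_liminfSet _).mem_of_tendsto htendsto ?_
    filter_upwards [self_mem_nhdsWithin] with s hs
    exact h.2 ⟨le_trans hx (EReal.coe_le_coe_iff.2 (le_of_lt hs)), hr.trans_lt hs⟩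

end Epigraph

section PolarTransform

variable {n : ℕ} {φ : EuclideanSpace ℝ (Fin n) → EReal} {y : EuclideanSpace ℝ (Fin n)}

theorem coe_div_le_coe_iff {a : EReal} (ha : 0 < a) {c s : ℝ} (hs : 0 ≤ s) :
    (c : EReal) / a ≤ s ↔ ∀ t : ℝ, a ≤ t → c ≤ s * t := by
  induction a with
  | bot => exact absurd ha (by simp)
  | top => simp [hs]
  | coe r =>
    rw [← EReal.coe_div, EReal.coe_le_coe_iff, div_le_iff₀ (EReal.coe_pos.1 ha)]
    refine ⟨fun h t hrt => h.trans ?_, fun h => h r le_rfl⟩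
    exact mul_le_mul_of_nonneg_left (EReal.coe_le_coe_iff.1 hrt) hs

theorem polarTransform_le_coe_iff {s : ℝ} (hs : 0 ≤ s) :
    polarTransform φ y ≤ s ↔ y ∈ polarSet {x | φ x = 0} ∧
      ∀ x, 0 < φ x → ((inner ℝ x y - 1 : ℝ) : EReal) / φ x ≤ s := by
  unfold polarTransform
  split_ifs with hy hpolar
  · subst hy
    refine iff_of_true (EReal.coe_nonneg.2 hs) ⟨fun x _ => ?_, fun x hx => ?_⟩
    · rw [inner_zero_right]
      exact zero_le_one
    · rw [inner_zero_right]
      refine (EReal.div_nonpos_of_nonpos_of_nonneg ?_ hx.le).trans (EReal.coe_nonneg.2 hs)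
      exact EReal.coe_nonpos.2 (by norm_num)
  · simp only [hpolar, true_and, iSup₂_le_iff, mem_ofPred_eq]
  · simp only [hpolar, false_and, top_le_iff, EReal.coe_ne_top]

theorem polarTransform_nonneg (hφ : ∀ x, 0 ≤ φ x) (y : EuclideanSpace ℝ (Fin n)) :
    0 ≤ polarTransform φ y := by
  unfold polarTransform
  split_ifs with hy hpolar
  · exact le_rfl
  · set x := (2 / ‖y‖ ^ 2) • y
    have hxy : inner ℝ x y = (2 : ℝ) := by
      rw [real_inner_smul_left, real_inner_self_eq_norm_sq,
        div_mul_cancel₀ _ (pow_ne_zero 2 (norm_ne_zero_iff.2 hy))]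
    have hx : 0 < φ x := (hφ x).lt_of_ne' fun h => by
      have := hpolar x h
      rw [hxy] at this
      norm_num at this
    refine le_iSup₂_of_le x hx (EReal.div_nonneg (EReal.coe_nonneg.2 ?_) hx.le)
    rw [hxy]
    norm_num
  · exact le_top

theorem mem_epi_polarTransform (hφ : ∀ x, 0 ≤ φ x) (hφ0 : φ 0 = 0) {s : ℝ} :
    (y, s) ∈ epi (polarTransform φ) ↔ ∀ x t, (x, t) ∈ epi φ → inner ℝ x y - s * t ≤ 1 := by
  have hle {s : ℝ} (hs : 0 ≤ s) : (y, s) ∈ epi (polarTransform φ) ↔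
      ∀ x t, (x, t) ∈ epi φ → inner ℝ x y - s * t ≤ 1 := by
    rw [mem_epi, polarTransform_le_coe_iff hs]
    constructor
    · rintro ⟨hzero, hpos⟩ x t hxt
      rcases (hφ x).eq_or_lt with h | h
      · have := mul_nonneg hs (epi_subset_nonneg_snd hφ hxt)
        linarith [hzero x h.symm]
      · linarith [(coe_div_le_coe_iff h hs).1 (hpos x h) t hxt]
    · refine fun h => ⟨fun x hx => ?_, fun x hx => (coe_div_le_coe_iff hx hs).2 fun t hxt => ?_⟩
      · simpa using h x 0 (mem_epi.2 (le_of_eq hx))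
      · linarith [h x t hxt]
  refine ⟨fun h => ?_, fun h => (hle ?_).2 h⟩
  · exact (hle (epi_subset_nonneg_snd (polarTransform_nonneg hφ) h)).1 h
  · by_contra! hs
    have h0 := h 0 (-2 / s) (mem_epi.2 (hφ0.trans_le
      (EReal.coe_nonneg.2 (div_nonneg_of_nonpos (by norm_num) hs.le))))
    rw [inner_zero_left, mul_div_cancel₀ _ hs.ne] at h0
    norm_num at h0

/-- The reflection `(x, t) ↦ (x, -t)`, starting from the `ℓ²`-product, which carries the inner
product needed by `innerPolar`. -/
noncomputable def reflectSnd (E : Type*) [TopologicalSpace E] : WithLp 2 (E × ℝ) ≃ₜ E × ℝ :=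
  (WithLp.homeomorphProd 2 E ℝ).trans ((Homeomorph.refl E).prodCongr (Homeomorph.neg ℝ))

theorem preimage_reflectSnd_epi_polarTransform (hφ : ∀ x, 0 ≤ φ x) (hφ0 : φ 0 = 0) :
    reflectSnd _ ⁻¹' epi (polarTransform φ) =
      innerPolar (WithLp.homeomorphProd 2 _ ℝ ⁻¹' epi φ) := by
  ext q
  have hinner (x : EuclideanSpace ℝ (Fin n)) (t : ℝ) :
      inner ℝ (WithLp.toLp 2 (x, t)) q = inner ℝ x q.fst - -q.snd * t := by
    rw [WithLp.prod_inner_apply, neg_mul, sub_neg_eq_add]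
    rfl
  refine (mem_epi_polarTransform hφ hφ0).trans ⟨fun h p hp => ?_, fun h x t hxt => ?_⟩
  · exact (hinner p.fst p.snd).trans_le (h p.fst p.snd hp)
  · exact (hinner x t).symm.trans_le (h (WithLp.toLp 2 (x, t)) hxt)

theorem tauTendsto_polarTransform_iff {φs : ℕ → EuclideanSpace ℝ (Fin n) → EReal}
    (hφs : ∀ m, IsGeometricConvex (φs m)) (hφ : IsGeometricConvex φ) :
    TauTendsto (fun m => polarTransform (φs m)) (polarTransform φ) ↔ TauTendsto φs φ := by
  let toProd := WithLp.homeomorphProd 2 (EuclideanSpace ℝ (Fin n)) ℝ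
  have hconvex {ψ : EuclideanSpace ℝ (Fin n) → EReal} (hψ : IsGeometricConvex ψ) :
      Convex ℝ (toProd ⁻¹' epi ψ) :=
    hψ.convex_epi.linear_preimage (WithLp.prodContinuousLinearEquiv 2 ℝ _ ℝ).toLinearMap
  have hclosed {ψ : EuclideanSpace ℝ (Fin n) → EReal} (hψ : IsGeometricConvex ψ) :
      IsClosed (toProd ⁻¹' epi ψ) :=
    hψ.isClosed_epi.preimage toProd.continuous
  have hzero {ψ : EuclideanSpace ℝ (Fin n) → EReal} (hψ : IsGeometricConvex ψ) :
      0 ∈ toProd ⁻¹' epi ψ :=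
    hψ.map_zero.le
  calc
    TauTendsto (fun m => polarTransform (φs m)) (polarTransform φ)
      ↔ SetTauTendsto (fun m => innerPolar (toProd ⁻¹' epi (φs m)))
          (innerPolar (toProd ⁻¹' epi φ)) := by
        simp only [TauTendsto, toProd,
          ← preimage_reflectSnd_epi_polarTransform (hφs _).nonneg (hφs _).map_zero,
          ← preimage_reflectSnd_epi_polarTransform hφ.nonneg hφ.map_zero,
          setTauTendsto_preimage_iff]
    _ ↔ SetTauTendsto (fun m => toProd ⁻¹' epi (φs m)) (toProd ⁻¹' epi φ) :=
        setTauTendsto_innerPolar_iff (fun m => hconvex (hφs m)) (fun m => hclosed (hφs m))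
          (fun m => hzero (hφs m)) (hconvex hφ) (hclosed hφ) (hzero hφ)
    _ ↔ TauTendsto φs φ := setTauTendsto_preimage_iff toProd

end PolarTransform

section GaugeTransform

variable {n : ℕ} {φ : EuclideanSpace ℝ (Fin n) → EReal}

theorem continuousOn_inv_snd_smul (E : Type*) [TopologicalSpace E] [MulAction ℝ E]
    [ContinuousSMul ℝ E] :
    ContinuousOn (fun p : E × ℝ => (p.2⁻¹ • p.1, p.2⁻¹)) {p | 0 < p.2} := by
  have : ContinuousOn (fun p : E × ℝ => p.2⁻¹) {p | 0 < p.2} :=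
    continuousOn_snd.inv₀ fun p hp => ne_of_gt hp
  fun_prop

/-- The involution `(x, t) ↦ (x / t, 1 / t)` of the open upper half-space. It exchanges the parts
over positive heights of the epigraphs of `φ` and of `gaugeTransform φ`. -/
noncomputable def halfSpaceInversion (E : Type*) [TopologicalSpace E] [MulAction ℝ E]
    [ContinuousSMul ℝ E] : OpenPartialHomeomorph (E × ℝ) (E × ℝ) where
  toFun p := (p.2⁻¹ • p.1, p.2⁻¹)
  invFun p := (p.2⁻¹ • p.1, p.2⁻¹)
  source := {p | 0 < p.2}
  target := {p | 0 < p.2}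
  map_source' _ (hp : 0 < _) := mem_ofPred.2 (inv_pos.2 hp)
  map_target' _ (hp : 0 < _) := mem_ofPred.2 (inv_pos.2 hp)
  left_inv' p (hp : 0 < p.2) := by simp [smul_smul, hp.ne']
  right_inv' p (hp : 0 < p.2) := by simp [smul_smul, hp.ne']
  open_source := isOpen_lt continuous_const continuous_snd
  open_target := isOpen_lt continuous_const continuous_snd
  continuousOn_toFun := continuousOn_inv_snd_smul E
  continuousOn_invFun := continuousOn_inv_snd_smul E

theorem gaugeTransform_nonneg (φ : EuclideanSpace ℝ (Fin n) → EReal)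
    (x : EuclideanSpace ℝ (Fin n)) : 0 ≤ gaugeTransform φ x := by
  refine le_sInf ?_
  rintro _ ⟨r, hr, rfl⟩
  exact EReal.coe_nonneg.2 hr.1.le

theorem inv_smul_mem_of_starConvex {E : Type*} [AddCommGroup E] [Module ℝ E] {S : Set E}
    (hS : StarConvex ℝ 0 S) {p : E} {r s : ℝ} (hr : 0 < r) (hrs : r ≤ s) (h : r⁻¹ • p ∈ S) :
    s⁻¹ • p ∈ S := by
  have hs : 0 < s := hr.trans_le hrs
  have := hS.smul_mem h (by positivity) ((div_le_one hs).2 hrs)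
  rwa [smul_smul, div_mul_eq_mul_div, mul_inv_cancel₀ hr.ne', one_div] at this

theorem mem_epi_gaugeTransform (hstar : StarConvex ℝ 0 (epi φ)) (hclosed : IsClosed (epi φ))
    {x : EuclideanSpace ℝ (Fin n)} {r : ℝ} (hr : 0 < r) :
    (x, r) ∈ epi (gaugeTransform φ) ↔ (r⁻¹ • x, r⁻¹) ∈ epi φ := by
  rw [mem_epi, gaugeTransform]
  refine ⟨fun h => ?_, fun h => sInf_le ⟨r, ⟨hr, h⟩, rfl⟩⟩
  have hsmul (s : ℝ) : (s⁻¹ • x, s⁻¹) = s⁻¹ • (x, (1 : ℝ)) := by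
    rw [Prod.smul_mk, smul_eq_mul, mul_one]
  have hgt : ∀ s > r, (s⁻¹ • x, s⁻¹) ∈ epi φ := fun s hs => by
    obtain ⟨_, ⟨q, ⟨hq, hqφ⟩, rfl⟩, hqs⟩ := sInf_lt_iff.1 (h.trans_lt (EReal.coe_lt_coe_iff.2 hs))
    have hqφ : (q⁻¹ • x, q⁻¹) ∈ epi φ := hqφ
    rw [hsmul] at hqφ ⊢
    exact inv_smul_mem_of_starConvex hstar hq (EReal.coe_lt_coe_iff.1 hqs).le hqφ
  have hinv : Tendsto (fun s : ℝ => s⁻¹) (𝓝[>] r) (𝓝 r⁻¹) :=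
    (tendsto_inv₀ hr.ne').mono_left nhdsWithin_le_nhds
  exact hclosed.mem_of_tendsto ((hinv.smul_const x).prodMk_nhds hinv)
    (eventually_mem_nhdsWithin.mono hgt)

theorem isImage_epi_gaugeTransform (hstar : StarConvex ℝ 0 (epi φ)) (hclosed : IsClosed (epi φ)) :
    (halfSpaceInversion _).IsImage (epi (gaugeTransform φ)) (epi φ) := by
  rintro ⟨x, r⟩ (hr : 0 < r)
  exact (mem_epi_gaugeTransform hstar hclosed hr).symm

theorem tauTendsto_gaugeTransform_iff {φs : ℕ → EuclideanSpace ℝ (Fin n) → EReal}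
    (hφs : ∀ m, IsGeometricConvex (φs m)) (hφ : IsGeometricConvex φ) :
    TauTendsto (fun m => gaugeTransform (φs m)) (gaugeTransform φ) ↔ TauTendsto φs φ := by
  have himage {ψ : EuclideanSpace ℝ (Fin n) → EReal} (hψ : IsGeometricConvex ψ) :
      (halfSpaceInversion _).IsImage (epi (gaugeTransform ψ)) (epi ψ) :=
    isImage_epi_gaugeTransform (hψ.convex_epi.starConvex hψ.map_zero.le) hψ.isClosed_epi
  rw [tauTendsto_iff_setTauTendstoOn_pos (fun m => gaugeTransform_nonneg _)
      (gaugeTransform_nonneg φ),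
    tauTendsto_iff_setTauTendstoOn_pos (fun m => (hφs m).nonneg) hφ.nonneg]
  exact setTauTendstoOn_iff_of_isImage (fun m => himage (hφs m)) (himage hφ)

end GaugeTransform

end GeomConvex

theorem mainTheorem4 {n : ℕ} (φs : ℕ → EuclideanSpace ℝ (Fin n) → EReal)
    (φ : EuclideanSpace ℝ (Fin n) → EReal)
    (hφs : ∀ m, GeomConvex.IsGeometricConvex (φs m)) (hφ : GeomConvex.IsGeometricConvex φ) :
    (GeomConvex.TauTendsto φs φ ↔
      GeomConvex.TauTendsto (fun m => GeomConvex.polarTransform (φs m))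
        (GeomConvex.polarTransform φ)) ∧
    (GeomConvex.TauTendsto φs φ ↔
      GeomConvex.TauTendsto (fun m => GeomConvex.gaugeTransform (φs m))
        (GeomConvex.gaugeTransform φ)) := by
  exact ⟨(GeomConvex.tauTendsto_polarTransform_iff hφs hφ).symm,
    (GeomConvex.tauTendsto_gaugeTransform_iff hφs hφ).symm⟩
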